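/- Let $G$ be a $\sigma$-compact, locally compact Hausdorff group with left Haar measure $\mu$, and let $L^2(G)=L^2(G,\mu)$ be the space of complex-valued square-integrable functions on $G$ modulo equality $\mu$-almost everywhere. Let $H$ be a discrete subgroup of $G$ that is amenable, that is, $H$ carries a finitely additive left-invariant probability measure defined on all of its subsets. For $\alpha=\sum_{h\in H}a_h h$ in the complex group ring $\mathbb{C}H$ (finitely many $a_h\neq 0$) and $f\in L^2(G)$, put $$\alpha * f=\sum_{h\in H}a_h L_h f,\qquad (L_hf)(x)=f(h^{-1}x).$$ If $\alpha\in\mathbb{C}H$ is a non-zerodivisor, in the sense that $\alpha\beta\neq 0$ for every nonzero $\beta\in\mathbb{C}H$, then $\alpha * f\neq 0$ for every nonzero $f\in L^2(G)$. -/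

import Mathlib

open MeasureTheory

/-- A discrete group `H` is amenable: there is a finitely additive probability measure `m`,
defined on all subsets of `H`, that is invariant under left translation. -/
def IsAmenableDiscrete (H : Type*) [Group H] : Prop :=
  ∃ m : Set H → ℝ,
    (∀ s : Set H, 0 ≤ m s) ∧
    m Set.univ = 1 ∧
    (∀ s t : Set H, Disjoint s t → m (s ∪ t) = m s + m t) ∧
    (∀ (h : H) (s : Set H), m ((fun x : H => h * x) '' s) = m s)

section

variable {G : Type*} [Group G] [MeasurableSpace G] [MeasurableMul G]
  (μ : Measure G) [μ.IsMulLeftInvariant]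

/-- Left translation on `L²(G)`: the class of `x ↦ f (g⁻¹ * x)`. -/
noncomputable def leftTranslation (g : G) (f : Lp ℂ 2 μ) : Lp ℂ 2 μ :=
  Lp.compMeasurePreserving (fun x : G => g⁻¹ * x) (measurePreserving_mul_left μ g⁻¹) f

/-- For a subgroup `H` of `G`, an element `α = ∑ a_h h` of the complex group ring of `H` and
`f ∈ L²(G)`, the convolution `α ∗ f` is the finite sum `∑ a_h L_h f` of left translates. -/
noncomputable def groupRingConv (H : Subgroup G) (α : MonoidAlgebra ℂ H) (f : Lp ℂ 2 μ) :
    Lp ℂ 2 μ :=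
  ∑ h ∈ α.coeff.support, α.coeff h • leftTranslation μ (h : G) f

end

open scoped Pointwise ENNReal

/-! ### Amenability and Følner sets. -/

section Folner

variable {H : Type*}

/-! Almost every restriction of `f` to an orbit `Hx` is square-summable (`ae_memℓp_orbit`), so it
suffices that `α` kills no nonzero ψ in ℓ²(H). Let P project onto the kernel K of `α` in ℓ²(H). K is
invariant under right translation, so if K ≠ 0 then ‖Pδ_x‖² ≥ c > 0 for all x, and for finite F the
sum of ‖Pδ_x‖² over F is at least c|F|.

That sum is at most the dimension of V = span P(δ_x), x ∈ F, which is at most the size of the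
boundary of F (`finrank_span_starProjection_le`). Følner sets make the boundary smaller than c|F|, a
contradiction. -/

theorem map_biUnion_of_finitelyAdditive {ι : Type*} {m : Set H → ℝ}
    (hadd : ∀ s t : Set H, Disjoint s t → m (s ∪ t) = m s + m t) (T : Finset ι) (A : ι → Set H)
    (hA : (T : Set ι).PairwiseDisjoint A) : m (⋃ i ∈ T, A i) = ∑ i ∈ T, m (A i) := by
  classical
  induction T using Finset.induction_on with
  | empty =>
    have h := hadd ∅ ∅ (Set.disjoint_empty _)
    rw [Set.union_empty] at h
    simpa using h
  | insert i T hi ih =>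
    rw [Finset.set_biUnion_insert, Finset.sum_insert hi, hadd, ih]
    · exact hA.subset (by simp)
    · rw [Set.disjoint_iUnion₂_right]
      intro j hj
      exact hA (by simp) (by simp [hj]) (by rintro rfl; exact hi hj)

variable [Group H] [DecidableEq H]

/-- No finite set is doubling for an amenable group: Hall's marriage theorem would otherwise
produce a paradoxical decomposition. -/
theorem IsAmenableDiscrete.exists_card_mul_lt (hH : IsAmenableDiscrete H) (S : Finset H) :
    ∃ F : Finset H, (S * F).card < 2 * F.card := by
  obtain ⟨m, hpos, huniv, hadd, hinv⟩ := hH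
  by_contra! hS
  have hall : ∀ T : Finset (H × Bool), T.card ≤ (T.biUnion fun p => S * {p.1}).card := by
    intro T
    have h1 : T ⊆ (T.image Prod.fst) ×ˢ Finset.univ := fun p hp => by
      simp only [Finset.mem_product, Finset.mem_univ, and_true]
      exact Finset.mem_image_of_mem _ hp
    have h2 : S * T.image Prod.fst ⊆ T.biUnion fun p => S * {p.1} := by
      intro y hy
      obtain ⟨s, hs, x, hx, rfl⟩ := Finset.mem_mul.1 hy
      obtain ⟨p, hp, rfl⟩ := Finset.mem_image.1 hx
      exact Finset.mem_biUnion.2 ⟨p, hp, Finset.mul_mem_mul hs (Finset.mem_singleton_self _)⟩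
    calc T.card ≤ _ := Finset.card_le_card h1
      _ = 2 * (T.image Prod.fst).card := by simp [mul_comm]
      _ ≤ _ := hS _
      _ ≤ _ := Finset.card_le_card h2
  obtain ⟨ψ, hψ, hmem⟩ := (Finset.all_card_le_biUnion_card_iff_exists_injective _).1 hall
  -- For each b, the pieces `A (s, b)` partition H by the factor s with which ψ moves x. Injectivity
  -- of ψ makes all their translates `B` disjoint, for total measure 2.
  let A : H × Bool → Set H := fun p => {x | ψ (x, p.2) = p.1 * x}
  let B : H × Bool → Set H := fun p => (fun x => p.1 * x) '' A p
  have hA : ∀ b, ∑ s ∈ S, m (A (s, b)) = 1 := by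
    intro b
    rw [← map_biUnion_of_finitelyAdditive hadd S (fun s => A (s, b)), ← huniv]
    · congr 1
      refine Set.eq_univ_of_forall fun x => ?_
      obtain ⟨s, hs, y, hy, h⟩ := Finset.mem_mul.1 (hmem (x, b))
      obtain rfl := Finset.mem_singleton.1 hy
      exact Set.mem_iUnion₂.2 ⟨s, hs, h.symm⟩
    · intro s _ t _ hst
      refine Set.disjoint_left.2 fun x hx hx' => hst ?_
      exact mul_right_cancel (hx.symm.trans hx' : s * x = t * x)
  have hB : ∑ p ∈ S ×ˢ Finset.univ, m (B p) = 2 := by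
    simp only [B, hinv]
    rw [Finset.sum_product_right]
    simp [hA]
  rw [← map_biUnion_of_finitelyAdditive hadd] at hB
  · have h := hadd (⋃ p ∈ S ×ˢ (Finset.univ : Finset Bool), B p) _ isCompl_compl.disjoint
    rw [Set.union_compl_self, huniv, hB] at h
    linarith [hpos (⋃ p ∈ S ×ˢ (Finset.univ : Finset Bool), B p)ᶜ]
  · rintro ⟨s, b⟩ _ ⟨t, c⟩ _ hne
    refine Set.disjoint_left.2 ?_
    rintro _ ⟨x, hx, rfl⟩ ⟨y, hy, hyx⟩
    have hx' : ψ (x, b) = s * x := hx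
    have hy' : ψ (y, c) = t * y := hy
    have hyx' : t * y = s * x := hyx
    have h := hψ (hx'.trans (hyx'.symm.trans hy'.symm))
    obtain ⟨rfl, rfl⟩ := Prod.mk.inj h
    exact hne (by rw [mul_right_cancel hyx'])

/-- Amenable groups have finite sets with arbitrarily small relative growth. -/
theorem IsAmenableDiscrete.exists_card_mul_le (hH : IsAmenableDiscrete H) (S : Finset H)
    {ε : ℝ} (hε : 0 < ε) :
    ∃ F : Finset H, F.Nonempty ∧ ((S * F).card : ℝ) ≤ (1 + ε) * F.card := by
  by_contra! hS
  have hpow : ∀ (n : ℕ) (F : Finset H), (1 + ε) ^ n * F.card ≤ ((S ^ n * F).card : ℝ) := by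
    intro n F
    rcases F.eq_empty_or_nonempty with rfl | hF
    · simp
    induction n with
    | zero => simp
    | succ n ih =>
      rcases (S ^ n * F).eq_empty_or_nonempty with h0 | h0
      · rw [h0] at ih
        have : 0 < (1 + ε) ^ n * (F.card : ℝ) :=
          mul_pos (by positivity) (by exact_mod_cast hF.card_pos)
        simp at ih
        linarith
      · rw [pow_succ', pow_succ' S, mul_assoc, mul_assoc]
        exact (mul_le_mul_of_nonneg_left ih (by positivity)).trans (hS _ h0).le
  obtain ⟨n, hn⟩ := pow_unbounded_of_one_lt 2 (by linarith : 1 < 1 + ε)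
  obtain ⟨F, hF⟩ := hH.exists_card_mul_lt (S ^ n)
  have h1 := hpow n F
  have h2 : ((S ^ n * F).card : ℝ) < 2 * F.card := by exact_mod_cast hF
  have h3 : (2 : ℝ) * F.card ≤ (1 + ε) ^ n * F.card := by gcongr
  linarith

/-- The Følner condition, in terms of the part of `S * F` missed by some translate of `F`. -/
theorem IsAmenableDiscrete.exists_card_boundary_le (hH : IsAmenableDiscrete H) (S : Finset H)
    {ε : ℝ} (hε : 0 < ε) :
    ∃ F : Finset H, F.Nonempty ∧
      ((S.biUnion fun s => (S * F) \ (s • F)).card : ℝ) ≤ ε * F.card := by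
  -- The boundary is a union of |S| pieces, each bounded by the growth; the `+ 1` covers empty S.
  obtain ⟨F, hF, hc⟩ := hH.exists_card_mul_le S (ε := ε / (S.card + 1)) (by positivity)
  refine ⟨F, hF, ?_⟩
  have h1 : ∀ s ∈ S, (((S * F) \ (s • F)).card : ℝ) ≤ ε / (S.card + 1) * F.card := by
    intro s hs
    have hsub : s • F ⊆ S * F := Finset.smul_finset_subset_mul hs
    rw [Finset.cast_card_sdiff hsub, Finset.card_smul_finset]
    linarith
  calc ((S.biUnion fun s => (S * F) \ (s • F)).card : ℝ)
      ≤ ∑ s ∈ S, (((S * F) \ (s • F)).card : ℝ) := by exact_mod_cast Finset.card_biUnion_le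
    _ ≤ ∑ s ∈ S, ε / (S.card + 1) * F.card := Finset.sum_le_sum h1
    _ = (S.card / (S.card + 1)) * (ε * F.card) := by
      rw [Finset.sum_const, nsmul_eq_mul]; ring
    _ ≤ 1 * (ε * F.card) := by
      gcongr
      rw [div_le_one (by positivity)]
      linarith
    _ = ε * F.card := one_mul _

end Folner

/-! ### A trace bound for projections. -/

section Bessel

variable {E ι : Type*} [NormedAddCommGroup E] [InnerProductSpace ℂ E]

/-- The trace of the compression of a projection to the span of finitely many orthonormal vectors
is at most its rank there. -/
theorem Orthonormal.sum_norm_starProjection_sq_le {e : ι → E} (he : Orthonormal ℂ e)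
    (K : Submodule ℂ E) [K.HasOrthogonalProjection] (F : Finset ι) :
    ∑ i ∈ F, ‖K.starProjection (e i)‖ ^ 2 ≤
      Module.finrank ℂ (Submodule.span ℂ ((fun i => K.starProjection (e i)) '' F)) := by
  set V := Submodule.span ℂ ((fun i => K.starProjection (e i)) '' F) with hV
  have hVK : V ≤ K := by
    rw [hV, Submodule.span_le]
    rintro _ ⟨i, -, rfl⟩
    exact K.starProjection_apply_mem _
  have : FiniteDimensional ℂ V :=
    FiniteDimensional.span_of_finite ℂ (F.finite_toSet.image _)
  let b := stdOrthonormalBasis ℂ V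
  -- Since `b j` lies in K, the projection can be dropped from the inner product; Bessel then
  -- applies to each `b j`.
  have h1 : ∀ i ∈ F, ‖K.starProjection (e i)‖ ^ 2 = ∑ j, ‖inner ℂ (e i) (b j : E)‖ ^ 2 := by
    intro i hi
    have hmem : K.starProjection (e i) ∈ V := Submodule.subset_span ⟨i, hi, rfl⟩
    have h := b.sum_sq_norm_inner_left ⟨_, hmem⟩
    rw [Submodule.coe_norm] at h
    rw [← h]
    refine Finset.sum_congr rfl fun j _ => ?_
    rw [Submodule.coe_inner, K.inner_starProjection_left_eq_right,
      K.starProjection_eq_self_iff.2 (hVK (b j).2)]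
  rw [Finset.sum_congr rfl h1, Finset.sum_comm]
  calc ∑ j, ∑ i ∈ F, ‖inner ℂ (e i) (b j : E)‖ ^ 2
      ≤ ∑ j, ‖(b j : E)‖ ^ 2 := Finset.sum_le_sum fun j _ => he.sum_inner_products_le _
    _ = Module.finrank ℂ V := by
      simp [← Submodule.coe_norm, b.orthonormal.1]

end Bessel

/-! ### Square-summable kernels over an amenable group. -/

section GroupAlgebra

variable {H : Type*} [Group H]

/-- Left convolution of an arbitrary function by an element of the group algebra. -/
noncomputable def functionConv (α : MonoidAlgebra ℂ H) : (H → ℂ) →ₗ[ℂ] (H → ℂ) where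
  toFun ψ k := ∑ h ∈ α.coeff.support, α.coeff h * ψ (h⁻¹ * k)
  map_add' ψ ξ := by ext k; simp [mul_add, Finset.sum_add_distrib]
  map_smul' c ψ := by ext k; simp [Finset.mul_sum, mul_left_comm]

theorem functionConv_apply (α : MonoidAlgebra ℂ H) (ψ : H → ℂ) (k : H) :
    functionConv α ψ k = ∑ h ∈ α.coeff.support, α.coeff h * ψ (h⁻¹ * k) := rfl

theorem coeff_mul_eq_functionConv (α β : MonoidAlgebra ℂ H) (k : H) :
    (α * β).coeff k = functionConv α β.coeff k := by
  classical
  rw [MonoidAlgebra.coeff_mul, functionConv_apply, Finsupp.sum]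
  refine Finset.sum_congr rfl fun h _ => ?_
  rw [Finsupp.sum, Finset.sum_eq_single (h⁻¹ * k)]
  · simp
  · intro x _ hx
    rw [if_neg]
    rintro rfl
    simp at hx
  · intro hx
    simp [Finsupp.notMem_support_iff.1 hx]

theorem functionConv_eq_zero_of_finite {α : MonoidAlgebra ℂ H}
    (hα : ∀ β : MonoidAlgebra ℂ H, β ≠ 0 → α * β ≠ 0) {ψ : H → ℂ}
    (hψ : (Function.support ψ).Finite) (h : functionConv α ψ = 0) : ψ = 0 := by
  by_contra hne
  refine hα (.ofCoeff (Finsupp.ofSupportFinite ψ hψ)) (fun h0 => hne ?_) ?_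
  · have := congrArg MonoidAlgebra.coeff h0
    ext k
    exact DFunLike.congr_fun this k
  · apply MonoidAlgebra.coeff_injective
    ext k
    rw [coeff_mul_eq_functionConv]
    exact congrFun h k

/-- Convolution of a truncated solution is supported on the boundary. -/
theorem functionConv_indicator_eq_zero [DecidableEq H] {α : MonoidAlgebra ℂ H} {ψ : H → ℂ}
    (h : functionConv α ψ = 0) (F : Finset H) {k : H}
    (hk : k ∉ α.coeff.support.biUnion fun s => (α.coeff.support * F) \ (s • F)) :
    functionConv α ((F : Set H).indicator ψ) k = 0 := by
  rw [functionConv_apply]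
  -- Off the boundary, if one translate `s⁻¹ * k` misses F then all do, and every term vanishes;
  -- otherwise truncation changes nothing.
  by_cases hF : ∃ s ∈ α.coeff.support, s⁻¹ * k ∉ F
  · obtain ⟨s, hs, hsk⟩ := hF
    refine Finset.sum_eq_zero fun t ht => ?_
    rw [Set.indicator_of_notMem, mul_zero]
    intro htk
    refine hk (Finset.mem_biUnion.2 ⟨s, hs, Finset.mem_sdiff.2 ⟨?_, ?_⟩⟩)
    · simpa using Finset.mul_mem_mul ht (Finset.mem_coe.1 htk)
    · rwa [← Finset.inv_smul_mem_iff, smul_eq_mul]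
  · push Not at hF
    refine Eq.trans ?_ (congrFun h k)
    exact Finset.sum_congr rfl fun s hs => by
      rw [Set.indicator_of_mem (Finset.mem_coe.2 (hF s hs))]

/-- The square-summable functions annihilated by left convolution with `α`. -/
noncomputable def convKernel (α : MonoidAlgebra ℂ H) : Submodule ℂ (lp (fun _ : H => ℂ) 2) :=
  ⨅ k : H, (∑ h ∈ α.coeff.support,
    α.coeff h • lp.evalCLM ℂ (fun _ : H => ℂ) 2 (h⁻¹ * k)).ker

theorem mem_convKernel {α : MonoidAlgebra ℂ H} {ψ : lp (fun _ : H => ℂ) 2} :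
    ψ ∈ convKernel α ↔ functionConv α ψ = 0 := by
  simp only [convKernel, Submodule.mem_iInf, LinearMap.mem_ker, funext_iff, functionConv_apply]
  refine forall_congr' fun k => ?_
  simp [lp.evalCLM]

theorem isClosed_convKernel (α : MonoidAlgebra ℂ H) :
    IsClosed (convKernel α : Set (lp (fun _ : H => ℂ) 2)) := by
  rw [convKernel, Submodule.coe_iInf]
  exact isClosed_iInter fun k => ContinuousLinearMap.isClosed_ker _

instance (α : MonoidAlgebra ℂ H) : CompleteSpace (convKernel α) :=
  (isClosed_convKernel α).completeSpace_coe

/-- The map sending ψ ∈ V to the boundary values of `α` convolved with ψ·1_F is injective: if they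
vanish, the finitely supported ψ·1_F is killed by `α`, hence zero. -/
theorem finrank_span_starProjection_le [DecidableEq H] {α : MonoidAlgebra ℂ H}
    (hα : ∀ β : MonoidAlgebra ℂ H, β ≠ 0 → α * β ≠ 0) (F : Finset H) :
    Module.finrank ℂ (Submodule.span ℂ
      ((fun x : H => (convKernel α).starProjection (lp.single 2 x (1 : ℂ))) '' F)) ≤
      (α.coeff.support.biUnion fun s => (α.coeff.support * F) \ (s • F)).card := by
  set K := convKernel α
  set B := α.coeff.support.biUnion fun s => (α.coeff.support * F) \ (s • F)
  set V := Submodule.span ℂ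
    ((fun x : H => K.starProjection (lp.single (E := fun _ : H => ℂ) 2 x (1 : ℂ))) '' F) with hV
  have hVK : V ≤ K := by
    rw [hV, Submodule.span_le]
    rintro _ ⟨i, -, rfl⟩
    exact K.starProjection_apply_mem _
  let T : (H → ℂ) →ₗ[ℂ] (H → ℂ) := functionConv α ∘ₗ
    { toFun := fun ψ => (F : Set H).indicator ψ
      map_add' := Set.indicator_add' _
      map_smul' := Set.indicator_const_smul _ }
  let Φ : V →ₗ[ℂ] (B → ℂ) :=
    { toFun := fun ψ k => T (ψ : lp (fun _ : H => ℂ) 2) k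
      map_add' := fun ψ ξ => funext fun k => congrFun (T.map_add _ _) k
      map_smul' := fun c ψ => funext fun k => congrFun (T.map_smul c _) k }
  have hΦ : Function.Injective Φ := by
    rw [← LinearMap.ker_eq_bot, LinearMap.ker_eq_bot']
    intro ψ hψ
    have hψK := hVK ψ.2
    have h0 : functionConv α ((F : Set H).indicator (ψ : lp (fun _ : H => ℂ) 2)) = 0 := by
      ext k
      by_cases hk : k ∈ B
      · exact congrFun hψ ⟨k, hk⟩
      · exact functionConv_indicator_eq_zero (mem_convKernel.1 hψK) F hk
    have h1 := functionConv_eq_zero_of_finite hα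
      (F.finite_toSet.subset Set.support_indicator_subset) h0
    -- As ψ ∈ K vanishes on F, it is orthogonal to the generators of V, while itself lying in V.
    have h2 : V ≤ (Submodule.span ℂ {(ψ : lp (fun _ : H => ℂ) 2)})ᗮ := by
      refine Submodule.span_le.2 ?_
      rintro _ ⟨x, hx, rfl⟩
      rw [SetLike.mem_coe, Submodule.mem_orthogonal_singleton_iff_inner_left,
        K.inner_starProjection_left_eq_right, K.starProjection_eq_self_iff.2 hψK,
        lp.inner_single_left]
      have := congrFun h1 x
      rw [Set.indicator_of_mem hx] at this
      simp [this]
    have h3 := Submodule.mem_orthogonal_singleton_iff_inner_left.1 (h2 ψ.2)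
    exact Subtype.ext (inner_self_eq_zero.1 h3)
  simpa using LinearMap.finrank_le_finrank_of_injective hΦ

/-- Right translation of a square-summable function. -/
noncomputable def lpRightTranslate (g : H) (φ : lp (fun _ : H => ℂ) 2) :
    lp (fun _ : H => ℂ) 2 :=
  ⟨fun k => φ (k * g), by
    have h := (memℓp_gen_iff (by norm_num)).1 (lp.memℓp φ)
    exact memℓp_gen ((Equiv.mulRight g).summable_iff.2 h)⟩

theorem lpRightTranslate_apply (g : H) (φ : lp (fun _ : H => ℂ) 2) (k : H) :
    lpRightTranslate g φ k = φ (k * g) := rfl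

theorem norm_lpRightTranslate (g : H) (φ : lp (fun _ : H => ℂ) 2) :
    ‖lpRightTranslate g φ‖ = ‖φ‖ := by
  rw [lp.norm_eq_tsum_rpow (by norm_num), lp.norm_eq_tsum_rpow (by norm_num)]
  congr 1
  exact (Equiv.mulRight g).tsum_eq fun k => ‖φ k‖ ^ (2 : ENNReal).toReal

theorem lpRightTranslate_mem_convKernel {α : MonoidAlgebra ℂ H} (g : H)
    {φ : lp (fun _ : H => ℂ) 2} (hφ : φ ∈ convKernel α) :
    lpRightTranslate g φ ∈ convKernel α := by
  rw [mem_convKernel] at hφ ⊢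
  ext k
  have := congrFun hφ (k * g)
  simpa [functionConv_apply, lpRightTranslate_apply, mul_assoc] using this

/-- A right translation within the kernel carries the value at y to x; Cauchy–Schwarz then gives a
lower bound uniform in x. -/
theorem norm_apply_le_norm_starProjection_mul [DecidableEq H] {α : MonoidAlgebra ℂ H}
    {φ : lp (fun _ : H => ℂ) 2} (hφ : φ ∈ convKernel α) (x y : H) :
    ‖φ y‖ ≤ ‖(convKernel α).starProjection (lp.single 2 x (1 : ℂ))‖ * ‖φ‖ := by
  have h := norm_inner_le_norm (𝕜 := ℂ) ((convKernel α).starProjection (lp.single 2 x (1 : ℂ)))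
    (lpRightTranslate (x⁻¹ * y) φ)
  rw [(convKernel α).inner_starProjection_left_eq_right, (convKernel α).starProjection_eq_self_iff.2
    (lpRightTranslate_mem_convKernel _ hφ), lp.inner_single_left, norm_lpRightTranslate,
    lpRightTranslate_apply] at h
  simpa using h

/-- Over an amenable group, a non-zerodivisor of the group algebra annihilates no nonzero
square-summable function. -/
theorem IsAmenableDiscrete.eq_zero_of_functionConv_eq_zero (hH : IsAmenableDiscrete H)
    {α : MonoidAlgebra ℂ H} (hα : ∀ β : MonoidAlgebra ℂ H, β ≠ 0 → α * β ≠ 0)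
    {φ : lp (fun _ : H => ℂ) 2} (h : functionConv α φ = 0) : φ = 0 := by
  classical
  by_contra hne
  have hφ := mem_convKernel.2 h
  have hnorm : 0 < ‖φ‖ := norm_pos_iff.2 hne
  obtain ⟨y, hy⟩ : ∃ y, φ y ≠ 0 := by
    by_contra! h0
    exact hne (lp.ext (funext h0))
  set c := (‖φ y‖ / ‖φ‖) ^ 2
  have hc : 0 < c := pow_pos (div_pos (norm_pos_iff.2 hy) hnorm) 2
  obtain ⟨F, hF, hB⟩ := hH.exists_card_boundary_le α.coeff.support (half_pos hc)
  have hcard : 0 < (F.card : ℝ) := by exact_mod_cast hF.card_pos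
  have horth : Orthonormal ℂ fun x : H => lp.single (E := fun _ : H => ℂ) 2 x (1 : ℂ) := by
    rw [orthonormal_iff_ite]
    intro i j
    rw [lp.inner_single_left, lp.single_apply]
    by_cases hij : i = j <;> simp [hij]
  have h1 := horth.sum_norm_starProjection_sq_le (convKernel α) F
  have h2 : F.card * c ≤
      ∑ x ∈ F, ‖(convKernel α).starProjection (lp.single 2 x (1 : ℂ))‖ ^ 2 := by
    rw [← nsmul_eq_mul]
    refine Finset.card_nsmul_le_sum _ _ _ fun x _ => ?_
    refine pow_le_pow_left₀ (by positivity) ?_ 2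
    rw [div_le_iff₀ hnorm]
    exact norm_apply_le_norm_starProjection_mul hφ x y
  have h3 : (_ : ℝ) ≤ _ := Nat.cast_le.2 (finrank_span_starProjection_le hα F)
  have h4 := h2.trans (h1.trans (h3.trans hB))
  nlinarith

end GroupAlgebra

/-! ### Restriction to orbits of a discrete subgroup. -/

section Orbits

variable {G : Type*} [Group G] [TopologicalSpace G] [IsTopologicalGroup G]

/-- A discrete subgroup admits an open neighbourhood of the identity whose translates by the
subgroup are pairwise disjoint. -/
theorem Subgroup.exists_open_pairwise_disjoint_smul (H : Subgroup G) [DiscreteTopology H] :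
    ∃ U : Set G, IsOpen U ∧ (1 : G) ∈ U ∧
      ∀ h k : H, ∀ x ∈ U, ∀ y ∈ U, (h : G) * x = k * y → h = k := by
  obtain ⟨O, hO, hO1⟩ := isOpen_induced_iff.1 (isOpen_discrete ({1} : Set H))
  have h1 : (1 : G) ∈ O := by
    have : (1 : H) ∈ Subtype.val ⁻¹' O := by rw [hO1]; rfl
    exact this
  obtain ⟨V, hV, hV1, hVO⟩ := exists_open_nhds_one_split (hO.mem_nhds h1)
  refine ⟨V ∩ V⁻¹, hV.inter hV.inv, ⟨hV1, by simpa using hV1⟩, ?_⟩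
  intro h k x hx y hy hxy
  have h2 : ((k⁻¹ * h : H) : G) = y * x⁻¹ := by
    rw [Subgroup.coe_mul, Subgroup.coe_inv, eq_mul_inv_iff_mul_eq, mul_assoc, hxy,
      inv_mul_cancel_left]
  have h3 : (k⁻¹ * h : H) ∈ Subtype.val ⁻¹' O := by
    rw [Set.mem_preimage, h2]
    exact hVO y hy.1 x⁻¹ hx.2
  rw [hO1, Set.mem_singleton_iff, inv_mul_eq_one] at h3
  exact h3.symm

theorem Subgroup.countable_of_discrete [T2Space G] [SigmaCompactSpace G] (H : Subgroup G)
    [DiscreteTopology H] : Countable H := by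
  have : IsClosed (H : Set G) := Subgroup.isClosed_of_discrete
  have : SigmaCompactSpace H := this.isClosedEmbedding_subtypeVal.sigmaCompactSpace
  exact countable_of_Lindelof_of_discrete

variable [MeasurableSpace G] [BorelSpace G] (μ : Measure G) [μ.IsMulLeftInvariant]

/-- On almost every orbit, `groupRingConv` is given by left convolution on the group. -/
theorem groupRingConv_coeFn_orbit {H : Subgroup G} [Countable H] (α : MonoidAlgebra ℂ H)
    (f : Lp ℂ 2 μ) :
    ∀ᵐ x ∂μ, ∀ k : H, groupRingConv μ H α f ((k : G) * x) =
      functionConv α (fun h : H => f ((h : G) * x)) k := by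
  have h1 : ∀ᵐ x ∂μ, groupRingConv μ H α f x =
      ∑ h ∈ α.coeff.support, α.coeff h * f ((h : G)⁻¹ * x) := by
    have hs := Lp.coeFn_finsetSum α.coeff.support
      (fun h : H => α.coeff h • leftTranslation μ (h : G) f)
    have ht : ∀ᵐ x ∂μ, ∀ h : H, (α.coeff h • leftTranslation μ (h : G) f : Lp ℂ 2 μ) x =
        α.coeff h * f ((h : G)⁻¹ * x) := by
      refine ae_all_iff.2 fun h => ?_
      filter_upwards [Lp.coeFn_smul (α.coeff h) (leftTranslation μ (h : G) f),
        Lp.coeFn_compMeasurePreserving f (measurePreserving_mul_left μ (h : G)⁻¹)] with x hx hx'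
      rw [hx, Pi.smul_apply, smul_eq_mul]
      exact congrArg _ hx'
    filter_upwards [hs, ht] with x hx hx'
    rw [groupRingConv, hx]
    simp [hx']
  refine ae_all_iff.2 fun k => ?_
  filter_upwards [(measurePreserving_mul_left μ (k : G)).quasiMeasurePreserving.ae h1] with x hx
  rw [hx, functionConv_apply]
  simp [mul_assoc]

variable [T2Space G] [SigmaCompactSpace G]

/-- Almost every orbit sum over a discrete subgroup of an integrable function is finite. -/
theorem ae_tsum_subgroup_lt_top (H : Subgroup G) [DiscreteTopology H] {F : G → ℝ≥0∞}
    (hF : Measurable F) (hint : ∫⁻ x, F x ∂μ ≠ ∞) :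
    ∀ᵐ x ∂μ, ∑' h : H, F ((h : G) * x) < ∞ := by
  have := H.countable_of_discrete
  obtain ⟨U, hU, hU1, hdisj⟩ := H.exists_open_pairwise_disjoint_smul
  -- `W g` is the right translate Ug, whose left H-translates stay disjoint; hence the orbit sum
  -- integrates over `W g` to at most the integral of F.
  let W : G → Set G := fun g => (fun x => x * g⁻¹) ⁻¹' U
  have hW : ∀ g, IsOpen (W g) := fun g => hU.preimage (continuous_mul_const _)
  obtain ⟨s, hs, hcover⟩ := countable_cover_nhds_of_sigmaCompact (f := W) fun g =>
    (hW g).mem_nhds (by simpa [W] using hU1)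
  rw [← Measure.restrict_univ (μ := μ), ← hcover, ae_restrict_biUnion_iff _ hs]
  intro g _
  have hmeas : ∀ h : H, Measurable fun x : G => F ((h : G) * x) :=
    fun h => hF.comp (measurable_const_mul _)
  refine ae_lt_top (Measurable.tsum hmeas) ?_
  rw [lintegral_tsum fun h => (hmeas h).aemeasurable]
  have hpre : ∀ h : H, W g = (fun x => (h : G) * x) ⁻¹' ((fun x => (h : G)⁻¹ * x) ⁻¹' W g) := by
    intro h; ext x; simp
  have hWm : ∀ h : H, MeasurableSet ((fun x => (h : G)⁻¹ * x) ⁻¹' W g) :=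
    fun h => (hW g).measurableSet.preimage (measurable_const_mul _)
  have hterm : ∀ h : H, ∫⁻ x in W g, F ((h : G) * x) ∂μ =
      ∫⁻ x in (fun x => (h : G)⁻¹ * x) ⁻¹' W g, F x ∂μ := by
    intro h
    conv_lhs => rw [hpre h]
    exact (measurePreserving_mul_left μ (h : G)).setLIntegral_comp_preimage (hWm h) hF
  simp_rw [hterm]
  rw [← lintegral_iUnion hWm]
  · exact ((setLIntegral_le_lintegral _ _).trans_lt hint.lt_top).ne
  · intro h k hhk
    refine Set.disjoint_left.2 fun x hx hx' => hhk ?_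
    exact hdisj h k _ hx _ hx' (by group)

/-- Almost every restriction of a square-integrable function to an orbit of a discrete subgroup
is square-summable. -/
theorem ae_memℓp_orbit (H : Subgroup G) [DiscreteTopology H] (f : Lp ℂ 2 μ) :
    ∀ᵐ x ∂μ, Memℓp (fun h : H => f ((h : G) * x)) 2 := by
  have hm : Measurable fun x => ‖f x‖ₑ ^ 2 := (Lp.stronglyMeasurable f).enorm.pow_const 2
  have hint : ∫⁻ x, ‖f x‖ₑ ^ 2 ∂μ ≠ ∞ := by
    have h := lintegral_rpow_enorm_lt_top_of_eLpNorm_lt_top (p := 2) (by norm_num) (by norm_num)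
      (Lp.memLp f).eLpNorm_lt_top
    simpa using h.ne
  filter_upwards [ae_tsum_subgroup_lt_top μ H hm hint] with x hx
  refine memℓp_gen ?_
  have h := ENNReal.summable_toReal hx.ne
  simpa using h

end Orbits

theorem mainTheorem4 {G : Type*} [Group G] [TopologicalSpace G] [IsTopologicalGroup G]
    [T2Space G] [LocallyCompactSpace G] [SigmaCompactSpace G]
    [MeasurableSpace G] [BorelSpace G]
    (μ : Measure G) [μ.IsHaarMeasure]
    (H : Subgroup G) [DiscreteTopology H] (hH : IsAmenableDiscrete H)
    (α : MonoidAlgebra ℂ H) (hα : ∀ β : MonoidAlgebra ℂ H, β ≠ 0 → α * β ≠ 0)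
    (f : Lp ℂ 2 μ) (hf : f ≠ 0) :
    groupRingConv μ H α f ≠ 0 := by
  intro h0
  have := H.countable_of_discrete
  have hz : groupRingConv μ H α f =ᵐ[μ] 0 := by
    rw [h0]
    exact Lp.coeFn_zero ℂ 2 μ
  have hz' : ∀ᵐ x ∂μ, ∀ k : H, groupRingConv μ H α f ((k : G) * x) = 0 :=
    ae_all_iff.2 fun k => (measurePreserving_mul_left μ (k : G)).quasiMeasurePreserving.ae hz
  refine hf ((Lp.eq_zero_iff_ae_eq_zero).2 ?_)
  filter_upwards [groupRingConv_coeFn_orbit μ α f, hz', ae_memℓp_orbit μ H f] with x hx hx0 hmem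
  have hφ := hH.eq_zero_of_functionConv_eq_zero hα
    (φ := (⟨fun h : H => f ((h : G) * x), hmem⟩ : lp (fun _ : H => ℂ) 2))
    (funext fun k => (hx k).symm.trans (hx0 k))
  -- The identity of H recovers the value at x itself.
  have h1 := congrFun (congrArg Subtype.val hφ) (1 : H)
  have h2 : f (((1 : H) : G) * x) = 0 := h1
  simpa using h2
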